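/- Let $k\in\mathbb N$ and let $c\ge 1$ be a real number. There are constants $\alpha,\beta,K>0$ and $N\in\mathbb N$, depending only on $k$ and $c$, such that the following holds for every tree $T=(V,E)$ with $n\ge N$ vertices and maximum degree at most $k$. Let $L$ be a set of $n$ labels. The true labeling is a bijection $M_T:L\to V$, with an arbitrary initial value. At each of the times $c,2c,3c,\dots$ the random evolver picks an edge of $T$, uniformly at random and independently of everything else, and exchanges the labels at its two endpoints. A probe-and-move algorithm maintains a hypothesis $M_H:L\to V$ (not necessarily injective, with an arbitrary initial value). At each of the times $1,2,3,\dots$ (after the evolver's swap, if there is one at the same time) it performs one step: depending on all earlier probes and answers, on the current hypothesis and possibly on random bits independent of the evolver, it chooses a label $l$ and a vertex $u$; an oracle answers null if $M_T(l)=u$, and otherwise returns the first edge on the path in $T$ from $u$ to $M_T(l)$; depending also on this answer, the algorithm leaves $M_H(l)$ unchanged or changes it to a vertex adjacent to $M_H(l)$. Let $$D(\mathcal T,\mathcal H)_{(t)}=\sum_{l\in L} d_T\bigl(M_T(l),M_H(l)\bigr)$$ be the total tree distance between the two labelings at time $t$. Then for every such algorithm, all initial labelings, and every real time $t\ge Kn$,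 $$\Pr\bigl[D(\mathcal T,\mathcal H)_{(t)}\ge \alpha n\bigr]\ \ge\ 1-e^{-\beta n}.$$ -/

import Mathlib

open MeasureTheory ProbabilityTheory

namespace EvolvingTree

/-- Edge sets are finite discrete spaces. -/
instance edgeSetMeasurableSpace {V : Type*} (T : SimpleGraph V) : MeasurableSpace T.edgeSet := ⊤

/-- The transposition of the two endpoints of an unordered pair. -/
def swapEdge {V : Type*} [DecidableEq V] (e : Sym2 V) : Equiv.Perm V :=
  Sym2.lift ⟨fun u v => Equiv.swap u v, fun u v => Equiv.swap_comm u v⟩ e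

/-- The true labeling after `j` swaps of the evolver, which starts at `M₀` and in its swap number
`j + 1` exchanges the labels at the two endpoints of `ξ j`. -/
def trueLabeling {V L : Type*} [DecidableEq V] {T : SimpleGraph V}
    (M₀ : L ≃ V) (ξ : ℕ → T.edgeSet) : ℕ → (L ≃ V)
  | 0 => M₀
  | j + 1 => (trueLabeling M₀ ξ j).trans (swapEdge (ξ j : Sym2 V))

/-- The unique path between two vertices of a tree. -/
noncomputable def treePath {V : Type*} {T : SimpleGraph V} (hT : T.IsTree) (u v : V) :
    T.Walk u v :=
  (hT.existsUnique_path u v).choose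

/-- The oracle: for a label `l` and a vertex `u` it returns `none` if `l` is located at `u`, and
otherwise the first edge of the path from `u` to the location of `l`. -/
noncomputable def oracle {V L : Type*} [DecidableEq V] {T : SimpleGraph V} (hT : T.IsTree)
    (M : L ≃ V) (l : L) (u : V) : Option (Sym2 V) :=
  if M l = u then none else some s(u, (treePath hT u (M l)).snd)

/-- The record of one probe: the pair (label, vertex) and the answer of the oracle. -/
abbrev Probe (L V : Type*) := (L × V) × Option (Sym2 V)

/-- A probe-and-move algorithm on the tree `T`. It may use a random seed `s : S` (take `S` a
one-point space for deterministic algorithms). In each step it chooses, from the seed, the list of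
all earlier probes (most recent first) and the current hypothesis, a label and a vertex; it sees
the oracle's answer, and it then leaves the chosen label where it is in the hypothesis or moves it
to an adjacent vertex. -/
structure ProbeMoveAlgorithm {V : Type*} (T : SimpleGraph V) (L S : Type*)
    [MeasurableSpace S] where
  query : S → List (Probe L V) → (L → V) → L × V
  move : S → List (Probe L V) → (L → V) → (L × V) → Option (Sym2 V) → V
  move_adj : ∀ s h H q a, move s h H q a = H q.1 ∨ T.Adj (H q.1) (move s h H q a)
  measurable_query : ∀ h H q, MeasurableSet {s | query s h H = q}
  measurable_move : ∀ h H q a v, MeasurableSet {s | move s h H q a = v}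

/-- The list of probes (most recent first) and the hypothesized labeling after `m` steps of the
algorithm. Step number `m` takes place at time `m`. The evolver with speedup factor `c` performs
its swap number `j` at time `c * j`, so at time `m` it has performed `⌊m / c⌋₊` swaps. -/
noncomputable def run {V L S : Type*} [DecidableEq V] [DecidableEq L] [MeasurableSpace S]
    {T : SimpleGraph V} (hT : T.IsTree) (c : ℝ) (A : ProbeMoveAlgorithm T L S) (s : S)
    (M₀ : L ≃ V) (H₀ : L → V) (ξ : ℕ → T.edgeSet) : ℕ → List (Probe L V) × (L → V)
  | 0 => ([], H₀)
  | m + 1 =>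
    let h := (run hT c A s M₀ H₀ ξ m).1
    let H := (run hT c A s M₀ H₀ ξ m).2
    let q := A.query s h H
    let a := oracle hT (trueLabeling M₀ ξ ⌊((m + 1 : ℕ) : ℝ) / c⌋₊) q.1 q.2
    ((q, a) :: h, Function.update H q.1 (A.move s h H q a))

/-- The sum over all labels of the tree distance between the positions in two labelings. -/
noncomputable def labelingDist {V L : Type*} [Fintype L] (T : SimpleGraph V) (M H : L → V) : ℕ :=
  ∑ l, T.dist (M l) (H l)

/-- The distance between the true and the hypothesized labeling at the real time `t ≥ 0`. -/
noncomputable def distAt {V L S : Type*} [DecidableEq V] [DecidableEq L] [Fintype L]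
    [MeasurableSpace S] {T : SimpleGraph V} (hT : T.IsTree) (c : ℝ)
    (A : ProbeMoveAlgorithm T L S) (s : S) (M₀ : L ≃ V) (H₀ : L → V) (ξ : ℕ → T.edgeSet)
    (t : ℝ) : ℕ :=
  labelingDist T (trueLabeling M₀ ξ ⌊t / c⌋₊) (run hT c A s M₀ H₀ ξ ⌊t⌋₊).2

/-- The uniformly random evolver: the swapped edges are independent and uniformly distributed. -/
structure IsUniformEvolver {Ω V : Type*} [MeasurableSpace Ω] (P : Measure Ω) (T : SimpleGraph V)
    (ξ : ℕ → Ω → T.edgeSet) : Prop where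
  measurable : ∀ j, Measurable (ξ j)
  uniform : ∀ j e, P.real {ω | ξ j ω = e} = 1 / (Nat.card T.edgeSet : ℝ)
  indep : iIndepFun ξ P

end EvolvingTree

open EvolvingTree

/-!
Fix the random bits and all swaps but the last `2 * r`, where `r` is a small multiple of `n`.
During the `O(r)` algorithm steps that overlap these swaps the oracle has at most `k + 1` answers
to each probe, so only exponentially many (in `r`) hypotheses can be reached. Each of them is
within distance `α * n` of at most `exp (ε * n)` labelings, with `ε` small if `α` is. Finally, a
labeling is reached by few words of `2 * r` swaps: a swap that shares no vertex with the other ones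
can be read off the resulting permutation, and one that does share a vertex has only `O(r)`
possible edges once the swap it touches is known. Reading the word forwards or backwards, at least
half of the swaps are restricted to `O(r)` out of `n - 1` edges in this way, so a fixed labeling
has a fraction of at most `O(r / n) ^ r` of all words, which for small `r / n` beats the two
exponential factors.
-/

namespace EvolvingTree

open Finset

section Counting

variable {E : Type*} [DecidableEq E]

/-- The positions at which the letter of the word `w` lies in the set that `F` assigns to the set of
all later letters. -/
def hits (F : Finset E → Finset E) {m : ℕ} (w : Fin m → E) : Finset (Fin m) :=
  {i | w i ∈ F ((Ioi i).image w)}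

theorem card_hits_cons (F : Finset E → Finset E) {m : ℕ} (e : E) (w : Fin m → E) :
    #(hits F (Fin.cons e w : Fin (m + 1) → E)) =
      (if e ∈ F (univ.image w) then 1 else 0) + #(hits F w) := by
  have later_zero : (Ioi 0).image (Fin.cons e w : Fin (m + 1) → E) = univ.image w := by
    rw [Fin.Ioi_zero_eq_map, map_eq_image, image_image]
    rfl
  have later_succ (i : Fin m) :
      (Ioi i.succ).image (Fin.cons e w : Fin (m + 1) → E) = (Ioi i).image w := by
    rw [← Fin.map_succEmb_Ioi, map_eq_image, image_image]
    rfl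
  simp only [hits, card_filter, Fin.sum_univ_succ, Fin.cons_zero, Fin.cons_succ, later_zero,
    later_succ]

variable [Fintype E]

theorem card_add_one_le_hits_le {F : Finset E → Finset E} {m q : ℕ}
    (hF : ∀ A, #A ≤ m → #(F A) ≤ q) (r : ℕ) :
    #{w : Fin (m + 1) → E | r + 1 ≤ #(hits F w)} ≤
      #{w : Fin m → E | r ≤ #(hits F w)} * q +
        #{w : Fin m → E | r + 1 ≤ #(hits F w)} * Fintype.card E := by
  have card_extensions_le (w : Fin m → E) :
      #{e | r + 1 ≤ #(hits F (Fin.cons e w : Fin (m + 1) → E))} ≤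
        (if r ≤ #(hits F w) then q else 0) +
          (if r + 1 ≤ #(hits F w) then Fintype.card E else 0) := by
    simp only [card_hits_cons]
    by_cases h₁ : r + 1 ≤ #(hits F w)
    · rw [if_pos h₁]
      exact (card_le_univ _).trans (Nat.le_add_left _ _)
    by_cases h₀ : r ≤ #(hits F w)
    · rw [if_pos h₀, if_neg h₁, add_zero]
      refine (card_le_card fun e he => ?_).trans
        (hF (univ.image w) (card_image_le.trans_eq (Finset.card_fin m)))
      by_contra hmem
      simp only [hmem, if_false, zero_add, mem_filter] at he
      exact h₁ he.2
    · rw [filter_false_of_mem fun e _ => by split_ifs <;> omega]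
      simp
  calc #{w : Fin (m + 1) → E | r + 1 ≤ #(hits F w)}
      = ∑ w : Fin m → E, #{e | r + 1 ≤ #(hits F (Fin.cons e w : Fin (m + 1) → E))} := by
        simp only [card_filter]
        rw [← (Fin.consEquiv fun _ => E).sum_comp, Fintype.sum_prod_type_right]
        rfl
    _ ≤ _ := sum_le_sum fun w _ => card_extensions_le w
    _ = _ := by simp [sum_add_distrib, ← sum_filter]

theorem card_le_hits_mul_pow_le {F : Finset E → Finset E} {m q : ℕ}
    (hF : ∀ A, #A ≤ m → #(F A) ≤ q) (r : ℕ) :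
    #{w : Fin m → E | r ≤ #(hits F w)} * Fintype.card E ^ r ≤
      (2 * Fintype.card E) ^ m * q ^ r := by
  set N := Fintype.card E
  induction m generalizing r with
  | zero =>
    cases r with
    | zero => simp
    | succ r => simp [hits]
  | succ m ih =>
    cases r with
    | zero =>
      simp only [zero_le, filter_true, card_univ, Fintype.card_fun, Fintype.card_fin, pow_zero,
        mul_one, mul_pow]
      exact Nat.le_mul_of_pos_left _ (by positivity)
    | succ r =>
      replace ih := ih fun A hA => hF A (hA.trans m.le_succ)
      calc _ ≤ (#{w : Fin m → E | r ≤ #(hits F w)} * q +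
              #{w : Fin m → E | r + 1 ≤ #(hits F w)} * N) * N ^ (r + 1) :=
            Nat.mul_le_mul_right _
              (card_add_one_le_hits_le (fun A hA => hF A (hA.trans m.le_succ)) r)
        _ = #{w : Fin m → E | r ≤ #(hits F w)} * N ^ r * (q * N) +
              #{w : Fin m → E | r + 1 ≤ #(hits F w)} * N ^ (r + 1) * N := by ring
        _ ≤ (2 * N) ^ m * q ^ r * (q * N) + (2 * N) ^ m * q ^ (r + 1) * N := by
            gcongr ?_ * (q * N) + ?_ * N
            exacts [ih r, ih (r + 1)]
        _ = (2 * N) ^ (m + 1) * q ^ (r + 1) := by ring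

end Counting

section Balls

variable {V L : Type*} {T : SimpleGraph V}

theorem exists_adj_dist_eq_of_dist_eq_succ {u v : V} {j : ℕ}
    (h : T.dist u v = j + 1) : ∃ w, T.Adj v w ∧ T.dist u w = j := by
  obtain ⟨p, hp⟩ := SimpleGraph.exists_walk_of_dist_ne_zero
    (show T.dist v u ≠ 0 by rw [SimpleGraph.dist_comm]; omega)
  rw [SimpleGraph.dist_comm, h] at hp
  cases p with
  | nil => simp at hp
  | @cons _ w _ hvw p =>
    have hw : T.dist u w ≤ j := by
      rw [SimpleGraph.dist_comm]
      exact (SimpleGraph.dist_le p).trans_eq (Nat.succ_injective hp)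
    exact ⟨w, hvw, by have := hvw.diff_dist_adj (u := u); omega⟩

variable [Fintype V]

theorem card_dist_eq_le [DecidableRel T.Adj] (hT : T.Connected) {d : ℕ} (hd : ∀ v, T.degree v ≤ d)
    (u : V) (j : ℕ) : #{v | T.dist u v = j} ≤ d ^ j := by
  classical
  induction j with
  | zero =>
    have : ({v | T.dist u v = 0} : Finset V) ⊆ {u} :=
      fun v => by simp [hT.dist_eq_zero_iff, eq_comm]
    simpa using card_le_card this
  | succ j ih =>
    have sphere_subset : ({v | T.dist u v = j + 1} : Finset V) ⊆
        ({v | T.dist u v = j} : Finset V).biUnion fun w => T.neighborFinset w := by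
      intro v hv
      obtain ⟨w, hvw, hw⟩ := exists_adj_dist_eq_of_dist_eq_succ (mem_filter.1 hv).2
      exact mem_biUnion.2 ⟨w, by simpa using hw, by simpa using hvw.symm⟩
    calc _ ≤ #{v | T.dist u v = j} * d :=
          (card_le_card sphere_subset).trans <| card_biUnion_le_card_mul _ _ d fun w _ => by
            simpa using hd w
      _ ≤ d ^ (j + 1) := Nat.mul_le_mul_right d ih

theorem sum_pow_dist_le [DecidableRel T.Adj] (hT : T.Connected) {d : ℕ} (hd : ∀ v, T.degree v ≤ d)
    (u : V) {x : ℝ} (hx : 0 ≤ x) (hdx : d * x ≤ 1 / 2) :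
    ∑ v, x ^ T.dist u v ≤ Real.exp (2 * (d * x)) := by
  have hy : 0 ≤ d * x := by positivity
  calc ∑ v, x ^ T.dist u v
      = ∑ j ∈ univ.image (T.dist u), #{v | T.dist u v = j} * x ^ j := by
        simp only [← nsmul_eq_mul]
        exact sum_comp (x ^ ·) (T.dist u)
    _ ≤ ∑ j ∈ univ.image (T.dist u), (d * x) ^ j := by
        refine sum_le_sum fun j _ => ?_
        rw [mul_pow]
        gcongr
        exact_mod_cast card_dist_eq_le hT hd u j
    _ ≤ ∑' j, (d * x) ^ j :=
        (summable_geometric_of_lt_one hy (by linarith)).sum_le_tsum _ fun j _ => pow_nonneg hy j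
    _ = (1 - d * x)⁻¹ := tsum_geometric_of_lt_one hy (by linarith)
    _ ≤ 2 * (d * x) + 1 := by
        rw [inv_le_iff_one_le_mul₀ (by linarith)]
        nlinarith
    _ ≤ Real.exp (2 * (d * x)) := Real.add_one_le_exp _

variable [Fintype L] [DecidableEq L]

theorem sum_pow_labelingDist (T : SimpleGraph V) (H : L → V) (x : ℝ) :
    ∑ M : L → V, x ^ labelingDist T M H = ∏ l, ∑ v, x ^ T.dist (H l) v := by
  simp only [labelingDist, ← prod_pow_eq_pow_sum, SimpleGraph.dist_comm (v := H _)]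
  rw [prod_univ_sum, Fintype.piFinset_univ]

/- Markov's inequality for the generating function of the distances to `H`. -/
theorem card_labelingDist_lt_le [DecidableRel T.Adj] (hT : T.Connected) {d : ℕ}
    (hd : ∀ v, T.degree v ≤ d) (H : L → V) (a : ℝ) {lam : ℝ} (hlam : 0 ≤ lam)
    (hdlam : d * Real.exp (-lam) ≤ 1 / 2) :
    (#{M : L → V | labelingDist T M H < a} : ℝ) ≤
      Real.exp (lam * a + 2 * (d * Real.exp (-lam)) * Fintype.card L) := by
  set x := Real.exp (-lam)
  have hx : 0 < x := Real.exp_pos _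
  have weight_ge : ∀ M : L → V, labelingDist T M H < a →
      Real.exp (-(lam * a)) ≤ x ^ labelingDist T M H := by
    intro M hM
    rw [← Real.exp_nat_mul]
    gcongr
    nlinarith
  have total_weight_le : ∑ M : L → V, x ^ labelingDist T M H ≤
      Real.exp (2 * (d * x) * Fintype.card L) := by
    rw [sum_pow_labelingDist, mul_comm, Real.exp_nat_mul, ← card_univ, ← prod_const]
    exact prod_le_prod (fun l _ => sum_nonneg fun v _ => by positivity)
      fun l _ => sum_pow_dist_le hT hd (H l) hx.le hdlam
  have markov : #{M : L → V | labelingDist T M H < a} * Real.exp (-(lam * a)) ≤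
      ∑ M : L → V, x ^ labelingDist T M H := by
    rw [← nsmul_eq_mul]
    exact (card_nsmul_le_sum _ _ _ fun M hM => weight_ge M (mem_filter.1 hM).2).trans
      (sum_le_univ_sum_of_nonneg fun M => by positivity)
  rw [Real.exp_neg, ← div_eq_mul_inv, div_le_iff₀ (Real.exp_pos _)] at markov
  rw [add_comm, Real.exp_add]
  exact markov.trans (by gcongr)

omit [DecidableEq L] in
theorem card_labelingDist_trans_lt_le [DecidableEq V] [DecidableRel T.Adj] (hT : T.Connected)
    {d : ℕ} (hd : ∀ v, T.degree v ≤ d) (M : L ≃ V) (H : L → V) (a : ℝ) {lam : ℝ} (hlam : 0 ≤ lam)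
    (hdlam : d * Real.exp (-lam) ≤ 1 / 2) :
    (#{π : Equiv.Perm V | labelingDist T (M.trans π) H < a} : ℝ) ≤
      Real.exp (lam * a + 2 * (d * Real.exp (-lam)) * Fintype.card L) := by
  classical
  refine le_trans ?_ (card_labelingDist_lt_le hT hd H a hlam hdlam)
  refine mod_cast card_le_card_of_injOn (fun π => ⇑(M.trans π))
    (fun π hπ => mem_filter.2 ⟨mem_univ _, (mem_filter.1 hπ).2⟩) ?_
  exact fun π _ π' _ h => Equiv.ext fun v => by simpa using congrFun h (M.symm v)

end Balls

section Swaps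

variable {V L : Type*} [DecidableEq V] {T : SimpleGraph V}

theorem swapEdge_apply_of_notMem {e : Sym2 V} {v : V} (h : v ∉ e) : swapEdge e v = v := by
  induction e with
  | h a b =>
    simp only [Sym2.mem_iff, not_or] at h
    exact Equiv.swap_apply_of_ne_of_ne h.1 h.2

theorem dependsOn_trueLabeling (M₀ : L ≃ V) (m : ℕ) :
    DependsOn (fun ξ : ℕ → T.edgeSet => trueLabeling M₀ ξ m) (Set.Iio m) := by
  intro ξ ξ' h
  induction m with
  | zero => rfl
  | succ m ih =>
    simp only [trueLabeling, ih fun j hj => h j (Set.Iio_subset_Iio m.le_succ hj),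
      h m (Set.mem_Iio.2 m.lt_succ_self)]

theorem trueLabeling_add (M₀ : L ≃ V) (ξ : ℕ → T.edgeSet) (i m : ℕ) :
    trueLabeling M₀ ξ (i + m) = trueLabeling (trueLabeling M₀ ξ i) (fun j => ξ (i + j)) m := by
  induction m with
  | zero => rfl
  | succ m ih => rw [← add_assoc, trueLabeling, trueLabeling, ih]

theorem trueLabeling_eq_trans (M₀ : L ≃ V) (ξ : ℕ → T.edgeSet) (m : ℕ) :
    trueLabeling M₀ ξ m = M₀.trans (trueLabeling (.refl V) ξ m) := by
  induction m with
  | zero => rfl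
  | succ m ih => simp only [trueLabeling, ih, Equiv.trans_assoc]

theorem trueLabeling_apply_of_forall_notMem {M₀ : L ≃ V} {ξ : ℕ → T.edgeSet} {m : ℕ} {l : L}
    (h : ∀ j < m, M₀ l ∉ (ξ j : Sym2 V)) : trueLabeling M₀ ξ m l = M₀ l := by
  induction m with
  | zero => rfl
  | succ m ih =>
    rw [trueLabeling, Equiv.trans_apply, ih fun j hj => h j (hj.trans m.lt_succ_self),
      swapEdge_apply_of_notMem (h m m.lt_succ_self)]

theorem trueLabeling_apply_of_isolated {M₀ : L ≃ V} {ξ : ℕ → T.edgeSet} {m i : ℕ} (hi : i < m)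
    {l : L} {v : V} (hξ : (ξ i : Sym2 V) = s(M₀ l, v))
    (h : ∀ j < m, j ≠ i → M₀ l ∉ (ξ j : Sym2 V) ∧ v ∉ (ξ j : Sym2 V)) :
    trueLabeling M₀ ξ m l = v := by
  have after_swap : trueLabeling M₀ ξ (i + 1) l = v := by
    rw [trueLabeling, Equiv.trans_apply,
      trueLabeling_apply_of_forall_notMem fun j hj => (h j (hj.trans hi) hj.ne).1, hξ]
    exact Equiv.swap_apply_left _ _
  obtain ⟨p, rfl⟩ := Nat.exists_eq_add_of_le hi
  rw [trueLabeling_add, trueLabeling_apply_of_forall_notMem, after_swap]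
  intro j hj
  rw [after_swap]
  exact (h (i + 1 + j) (by omega) (by omega)).2

variable [Fintype V]

theorem card_support_trueLabeling_refl_le (ξ : ℕ → T.edgeSet) (m : ℕ) :
    #(Equiv.Perm.support (trueLabeling (.refl V) ξ m)) ≤ 2 * m := by
  induction m with
  | zero => exact (congrArg card Equiv.Perm.support_one).trans_le (by simp)
  | succ m ih =>
    have card_support_swapEdge : #(swapEdge (ξ m : Sym2 V)).support ≤ 2 := by
      obtain ⟨⟨u, v⟩, he⟩ := ξ m
      exact (Equiv.Perm.card_support_swap (T.mem_edgeSet.1 he).ne).le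
    exact (card_le_card (Equiv.Perm.support_mul_le _ _)).trans
      ((card_union_le _ _).trans (by omega))

variable [DecidableRel T.Adj]

variable (T) in
open scoped Classical in
/-- The edges along which the permutation `π` of the vertices moves one of their endpoints to the
other one. -/
noncomputable def movedEdges (π : Equiv.Perm V) : Finset T.edgeSet :=
  {e | ∃ u, (e : Sym2 V) = s(u, π u)}

open scoped Classical in
/-- The edges that have an endpoint in common with an edge from `A`, those of `A` included. -/
noncomputable def touching (A : Finset T.edgeSet) : Finset T.edgeSet :=
  {e | ∃ f ∈ A, ∃ v, v ∈ (e : Sym2 V) ∧ v ∈ (f : Sym2 V)}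

theorem card_movedEdges_le (π : Equiv.Perm V) : #(movedEdges T π) ≤ #π.support := by
  rw [← card_map (.subtype _)]
  refine (card_le_card (t := π.support.image fun u => s(u, π u)) fun e he => ?_).trans
    card_image_le
  obtain ⟨⟨e, hadj⟩, hmoved, rfl⟩ := mem_map.1 he
  obtain ⟨u, rfl⟩ := (mem_filter.1 hmoved).2
  exact mem_image_of_mem _ (Equiv.Perm.mem_support.2 (T.mem_edgeSet.1 hadj).ne')

theorem card_incident_eq_degree (v : V) :
    #{e : T.edgeSet | v ∈ (e : Sym2 V)} = T.degree v := by
  rw [← SimpleGraph.card_incidenceFinset_eq_degree, ← card_map (.subtype _)]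
  congr 1
  ext e
  simp [SimpleGraph.incidenceSet, and_comm]

theorem card_touching_le {d : ℕ} (hd : ∀ v, T.degree v ≤ d) (A : Finset T.edgeSet) :
    #(touching A) ≤ 2 * d * #A := by
  have touching_subset : touching A ⊆ A.biUnion fun f =>
      (f : Sym2 V).toFinset.biUnion fun v => {e | v ∈ (e : Sym2 V)} := by
    intro e he
    simpa [touching, and_comm] using he
  rw [mul_comm]
  refine (card_le_card touching_subset).trans (card_biUnion_le_card_mul _ _ _ fun f _ => ?_)
  refine (card_biUnion_le_card_mul _ _ d fun v _ =>
    (card_incident_eq_degree v).trans_le (hd v)).trans (Nat.mul_le_mul_right d ?_)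
  rw [Sym2.card_toFinset]
  split_ifs <;> omega

theorem mem_movedEdges_of_isolated {ξ : ℕ → T.edgeSet} {m i : ℕ} (hi : i < m)
    (h : ∀ j < m, j ≠ i → ∀ v ∈ (ξ i : Sym2 V), v ∉ (ξ j : Sym2 V)) :
    ξ i ∈ movedEdges T (trueLabeling (.refl V) ξ m) := by
  obtain ⟨u, v, huv⟩ : ∃ u v, (ξ i : Sym2 V) = s(u, v) := Sym2.exists.1 ⟨_, rfl⟩
  have moved : trueLabeling (.refl V) ξ m u = v :=
    trueLabeling_apply_of_isolated hi huv fun j hj hji =>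
      ⟨h j hj hji u (by simp [huv]), h j hj hji v (by simp [huv])⟩
  exact mem_filter.2 ⟨mem_univ _, u, moved ▸ huv⟩

variable (T) in
/-- The edges that a swap may use if the swaps lead to the permutation `π` and the other swaps
considered use the edges in `A`: see `mem_hits_or_rev_mem_hits`. -/
noncomputable def candidateEdges (π : Equiv.Perm V) (A : Finset T.edgeSet) : Finset T.edgeSet :=
  movedEdges T π ∪ touching A

theorem card_candidateEdges_le {d : ℕ} (hd : ∀ v, T.degree v ≤ d) (π : Equiv.Perm V)
    (A : Finset T.edgeSet) : #(candidateEdges T π A) ≤ #π.support + 2 * d * #A :=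
  (card_union_le _ _).trans (Nat.add_le_add (card_movedEdges_le π) (card_touching_le hd A))

variable {m : ℕ} {w : Fin m → T.edgeSet} {g : ℕ → T.edgeSet} {π : Equiv.Perm V}

theorem mem_hits_or_rev_mem_hits
    (hπ : trueLabeling (.refl V) (Function.extend Fin.val w g) m = π) (i : Fin m) :
    i ∈ hits (candidateEdges T π) w ∨ i.rev ∈ hits (candidateEdges T π) (w ∘ Fin.rev) := by
  have extend_val (j : Fin m) : Function.extend Fin.val w g j = w j :=
    Fin.val_injective.extend_apply w g j
  by_contra! hi
  simp only [hits, candidateEdges, mem_filter, mem_univ, true_and, mem_union, not_or, touching,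
    mem_image, mem_Ioi, Function.comp_apply, Fin.rev_rev] at hi
  obtain ⟨⟨not_moved, no_later⟩, -, no_earlier⟩ := hi
  rw [← extend_val i, ← hπ] at not_moved
  refine not_moved (mem_movedEdges_of_isolated i.2 fun j hj hji v hv hv' => ?_)
  lift j to Fin m using hj
  rw [extend_val] at hv hv'
  rcases lt_or_gt_of_ne hji with hlt | hlt
  · exact no_earlier ⟨w j, ⟨j.rev, Fin.rev_lt_rev.2 hlt, by simp⟩, v, hv, hv'⟩
  · exact no_later ⟨w j, ⟨j, hlt, rfl⟩, v, hv, hv'⟩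

theorem le_card_hits_add_card_hits_rev
    (hπ : trueLabeling (.refl V) (Function.extend Fin.val w g) m = π) :
    m ≤ #(hits (candidateEdges T π) w) + #(hits (candidateEdges T π) (w ∘ Fin.rev)) := by
  set F := candidateEdges T π
  calc m = #(univ : Finset (Fin m)) := (Finset.card_fin m).symm
    _ ≤ #(hits F w ∪ (hits F (w ∘ Fin.rev)).image Fin.rev) :=
      card_le_card fun i _ => mem_union.2 <| (mem_hits_or_rev_mem_hits hπ i).imp_right fun h =>
        mem_image.2 ⟨i.rev, h, i.rev_rev⟩
    _ ≤ _ := (card_union_le _ _).trans (Nat.add_le_add_left card_image_le _)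

theorem card_trueLabeling_eq_mul_pow_le {d : ℕ} (hd : ∀ v, T.degree v ≤ d) (g : ℕ → T.edgeSet)
    (π : Equiv.Perm V) (r : ℕ) :
    #{w : Fin (2 * r) → T.edgeSet |
        trueLabeling (.refl V) (Function.extend Fin.val w g) (2 * r) = π} *
        Fintype.card T.edgeSet ^ r ≤
      2 * ((2 * Fintype.card T.edgeSet) ^ (2 * r) * (4 * (d + 1) * r) ^ r) := by
  set fibre : Finset (Fin (2 * r) → T.edgeSet) :=
    {w | trueLabeling (.refl V) (Function.extend Fin.val w g) (2 * r) = π}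
  obtain hempty | ⟨w₀, hw₀⟩ := fibre.eq_empty_or_nonempty
  · simp [hempty]
  have card_support_le : #π.support ≤ 2 * (2 * r) := by
    rw [← (mem_filter.1 hw₀).2]
    exact card_support_trueLabeling_refl_le _ _
  have card_candidates_le (A : Finset T.edgeSet) (hA : #A ≤ 2 * r) :
      #(candidateEdges T π A) ≤ 4 * (d + 1) * r := by
    have : 2 * d * #A ≤ 2 * d * (2 * r) := Nat.mul_le_mul_left _ hA
    linarith [card_candidateEdges_le hd π A]
  set many : Finset (Fin (2 * r) → T.edgeSet) := {w | r ≤ #(hits (candidateEdges T π) w)}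
  have fibre_subset : fibre ⊆ many ∪ many.image (· ∘ Fin.rev) := by
    intro w hw
    have many_hits := le_card_hits_add_card_hits_rev (mem_filter.1 hw).2
    by_cases h : r ≤ #(hits (candidateEdges T π) w)
    · exact mem_union_left _ (mem_filter.2 ⟨mem_univ _, h⟩)
    · refine mem_union_right _
        (mem_image.2 ⟨w ∘ Fin.rev, mem_filter.2 ⟨mem_univ _, by omega⟩, ?_⟩)
      simp [Function.comp_assoc, Fin.rev_involutive.comp_self]
  have card_fibre_le : #fibre ≤ #many + #many :=
    (card_le_card fibre_subset).trans
      ((card_union_le _ _).trans (Nat.add_le_add_left card_image_le _))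
  calc _ ≤ (#many + #many) * Fintype.card T.edgeSet ^ r := Nat.mul_le_mul_right _ card_fibre_le
    _ = 2 * (#many * Fintype.card T.edgeSet ^ r) := by ring
    _ ≤ _ := Nat.mul_le_mul_left _ (card_le_hits_mul_pow_le card_candidates_le r)

end Swaps

section Runs

section Answers

variable {V L : Type*} [DecidableEq V] [Fintype V] {T : SimpleGraph V} [DecidableRel T.Adj]

variable (T) in
/-- The answers that the oracle may give to a query at the vertex `u`. -/
def answers (u : V) : Finset (Option (Sym2 V)) :=
  insert none ((T.neighborFinset u).image fun v => some s(u, v))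

theorem card_answers_le {d : ℕ} (hd : ∀ v, T.degree v ≤ d) (u : V) : #(answers T u) ≤ d + 1 :=
  (card_insert_le _ _).trans (Nat.add_le_add_right (card_image_le.trans (hd u)) 1)

theorem oracle_mem_answers (hT : T.IsTree) (M : L ≃ V) (l : L) (u : V) :
    oracle hT M l u ∈ answers T u := by
  unfold oracle
  split_ifs with h
  · exact mem_insert_self _ _
  · exact mem_insert_of_mem <| mem_image.2
      ⟨_, by simpa using SimpleGraph.Walk.adj_snd (SimpleGraph.Walk.not_nil_of_ne (Ne.symm h)), rfl⟩

end Answers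

variable {V L S : Type*} [DecidableEq V] [DecidableEq L] [MeasurableSpace S] {T : SimpleGraph V}

/-- The state of the algorithm after one step from the state `y` in which the oracle answers `a`. -/
def stepState (A : ProbeMoveAlgorithm T L S) (s : S) (y : List (Probe L V) × (L → V))
    (a : Option (Sym2 V)) : List (Probe L V) × (L → V) :=
  let q := A.query s y.1 y.2
  ((q, a) :: y.1, Function.update y.2 q.1 (A.move s y.1 y.2 q a))

theorem run_succ (hT : T.IsTree) (c : ℝ) (A : ProbeMoveAlgorithm T L S) (s : S)
    (M₀ : L ≃ V) (H₀ : L → V) (ξ : ℕ → T.edgeSet) (m : ℕ) :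
    let y := run hT c A s M₀ H₀ ξ m
    let q := A.query s y.1 y.2
    run hT c A s M₀ H₀ ξ (m + 1) =
      stepState A s y (oracle hT (trueLabeling M₀ ξ ⌊((m + 1 : ℕ) : ℝ) / c⌋₊) q.1 q.2) :=
  rfl

section DependsOn

variable (hT : T.IsTree) {c : ℝ} (hc : 0 < c) (A : ProbeMoveAlgorithm T L S) (s : S)
  (M₀ : L ≃ V) (H₀ : L → V)

include hc in
theorem dependsOn_run (m : ℕ) :
    DependsOn (fun ξ => run hT c A s M₀ H₀ ξ m) (Set.Iio ⌊(m : ℝ) / c⌋₊) := by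
  intro ξ ξ' h
  induction m with
  | zero => rfl
  | succ m ih =>
    have floor_mono : ⌊(m : ℝ) / c⌋₊ ≤ ⌊((m + 1 : ℕ) : ℝ) / c⌋₊ := by
      gcongr
      exact m.le_succ
    simp only [run_succ, ih fun j hj => h j (Set.Iio_subset_Iio floor_mono hj),
      dependsOn_trueLabeling M₀ _ h]

include hc in
theorem dependsOn_distAt [Fintype L] {t : ℝ} (ht : 0 ≤ t) :
    DependsOn (fun ξ => distAt hT c A s M₀ H₀ ξ t) (Set.Iio ⌊t / c⌋₊) := by
  intro ξ ξ' h
  have floor_mono : ⌊(⌊t⌋₊ : ℝ) / c⌋₊ ≤ ⌊t / c⌋₊ := by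
    gcongr
    exact Nat.floor_le ht
  simp only [distAt, dependsOn_trueLabeling M₀ _ h,
    dependsOn_run hT hc A s M₀ H₀ _ fun j hj => h j (Set.Iio_subset_Iio floor_mono hj)]

end DependsOn

section Measurability

variable [Finite V] [Finite L] (hT : T.IsTree) (c : ℝ) (A : ProbeMoveAlgorithm T L S)
  (M₀ : L ≃ V) (H₀ : L → V) (ξ : ℕ → T.edgeSet)

theorem measurableSet_run_eq (m : ℕ) (y : List (Probe L V) × (L → V)) :
    MeasurableSet {s | run hT c A s M₀ H₀ ξ m = y} := by
  induction m generalizing y with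
  | zero =>
    simp only [run]
    exact .const _
  | succ m ih =>
    let a (q : L × V) : Option (Sym2 V) :=
      oracle hT (trueLabeling M₀ ξ ⌊((m + 1 : ℕ) : ℝ) / c⌋₊) q.1 q.2
    have eq_iUnion : {s | run hT c A s M₀ H₀ ξ (m + 1) = y} =
        ⋃ x : List (Probe L V) × (L → V), ⋃ q : L × V, ⋃ v : V,
          {s | run hT c A s M₀ H₀ ξ m = x} ∩ {s | A.query s x.1 x.2 = q} ∩
            {s | A.move s x.1 x.2 q (a q) = v} ∩
            {_s | ((q, a q) :: x.1, Function.update x.2 q.1 v) = y} := by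
      ext s
      simp only [Set.mem_iUnion, Set.mem_inter_iff, Set.mem_ofPred_eq, run_succ, stepState]
      constructor
      · exact fun h => ⟨_, _, _, ⟨⟨rfl, rfl⟩, rfl⟩, h⟩
      · rintro ⟨x, q, v, ⟨⟨rfl, rfl⟩, rfl⟩, h⟩
        exact h
    rw [eq_iUnion]
    exact .iUnion fun x => .iUnion fun q => .iUnion fun v =>
      (((ih x).inter (A.measurable_query _ _ _)).inter (A.measurable_move _ _ _ _ _)).inter
        (.const _)

theorem measurableSet_distAt_lt [Fintype L] (t x : ℝ) :
    MeasurableSet {s | (distAt hT c A s M₀ H₀ ξ t : ℝ) < x} := by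
  have eq_iUnion : {s | (distAt hT c A s M₀ H₀ ξ t : ℝ) < x} =
      ⋃ y : List (Probe L V) × (L → V), {s | run hT c A s M₀ H₀ ξ ⌊t⌋₊ = y} ∩
        {_s | (labelingDist T (trueLabeling M₀ ξ ⌊t / c⌋₊) y.2 : ℝ) < x} := by
    ext s
    simp [distAt]
  rw [eq_iUnion]
  exact .iUnion fun y => (measurableSet_run_eq hT c A M₀ H₀ ξ _ y).inter (.const _)

end Measurability

section Reachable

variable [Fintype V] [DecidableRel T.Adj]

/-- The states to which `p` steps can lead the algorithm from the state `x`, whatever the oracle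
answers. -/
def reachableStates [Fintype L] (A : ProbeMoveAlgorithm T L S) (s : S)
    (x : List (Probe L V) × (L → V)) : ℕ → Finset (List (Probe L V) × (L → V))
  | 0 => {x}
  | p + 1 => (reachableStates A s x p).biUnion fun y =>
      (answers T (A.query s y.1 y.2).2).image (stepState A s y)

variable [Fintype L]

theorem card_reachableStates_le {d : ℕ} (hd : ∀ v, T.degree v ≤ d)
    (A : ProbeMoveAlgorithm T L S) (s : S) (x : List (Probe L V) × (L → V)) (p : ℕ) :
    #(reachableStates A s x p) ≤ (d + 1) ^ p := by
  induction p with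
  | zero => simp [reachableStates]
  | succ p ih =>
    exact (card_biUnion_le_card_mul _ _ (d + 1) fun y _ =>
      card_image_le.trans (card_answers_le hd _)).trans (Nat.mul_le_mul_right _ ih)

theorem run_add_mem_reachableStates (hT : T.IsTree) (c : ℝ) (A : ProbeMoveAlgorithm T L S) (s : S)
    (M₀ : L ≃ V) (H₀ : L → V) (ξ : ℕ → T.edgeSet) (m p : ℕ) :
    run hT c A s M₀ H₀ ξ (m + p) ∈ reachableStates A s (run hT c A s M₀ H₀ ξ m) p := by
  induction p with
  | zero => simp [reachableStates]
  | succ p ih =>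
    rw [← add_assoc, run_succ]
    exact mem_biUnion.2 ⟨_, ih, mem_image_of_mem _ (oracle_mem_answers hT _ _ _)⟩

theorem exists_mem_reachableStates_distAt_eq (hT : T.IsTree) {c : ℝ} (hc : 0 < c)
    (A : ProbeMoveAlgorithm T L S) (s : S) (M₀ : L ≃ V) (H₀ : L → V) {ξ ξ₀ : ℕ → T.edgeSet}
    {i m p : ℕ} {t : ℝ} (hi : ⌊t / c⌋₊ = i + m) (hp : ⌊t⌋₊ = ⌊i * c⌋₊ + p)
    (h : ∀ j < i, ξ j = ξ₀ j) :
    ∃ y ∈ reachableStates A s (run hT c A s M₀ H₀ ξ₀ ⌊i * c⌋₊) p,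
      distAt hT c A s M₀ H₀ ξ t = labelingDist T
        ((trueLabeling M₀ ξ₀ i).trans (trueLabeling (.refl V) (fun j => ξ (i + j)) m)) y.2 := by
  have floor_le : ⌊(⌊i * c⌋₊ : ℝ) / c⌋₊ ≤ i :=
    Nat.floor_le_of_le ((div_le_iff₀ hc).2 (Nat.floor_le (by positivity)))
  refine ⟨run hT c A s M₀ H₀ ξ ⌊t⌋₊, ?_, ?_⟩
  · have same_run : run hT c A s M₀ H₀ ξ ⌊i * c⌋₊ = run hT c A s M₀ H₀ ξ₀ ⌊i * c⌋₊ :=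
      dependsOn_run hT hc A s M₀ H₀ _ fun j hj => h j (hj.trans_le floor_le)
    rw [hp, ← same_run]
    exact run_add_mem_reachableStates hT c A s M₀ H₀ ξ _ p
  · have same_labeling : trueLabeling M₀ ξ i = trueLabeling M₀ ξ₀ i :=
      dependsOn_trueLabeling M₀ i h
    rw [distAt, hi, trueLabeling_add, same_labeling, trueLabeling_eq_trans]

theorem exists_le_floor_eq_floor_mul_add {c t : ℝ} (hc : 0 < c) {i r : ℕ} (hr : 1 ≤ r)
    (hi : ⌊t / c⌋₊ = i + 2 * r) : ∃ p ≤ r * ⌈3 * c + 1⌉₊, ⌊t⌋₊ = ⌊i * c⌋₊ + p := by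
  have hr' : (1 : ℝ) ≤ r := by exact_mod_cast hr
  have swaps_le : (i + 2 * r : ℝ) * c ≤ t := by
    rw [← le_div_iff₀ hc]
    exact_mod_cast (Nat.le_floor_iff' (by omega)).1 hi.ge
  have lt_swaps : t < (i + 2 * r + 1) * c := by
    rw [← div_lt_iff₀ hc]
    exact_mod_cast hi ▸ Nat.lt_floor_add_one (t / c)
  have floor_mono : ⌊i * c⌋₊ ≤ ⌊t⌋₊ := Nat.floor_le_floor (by nlinarith)
  have floor_le : (⌊t⌋₊ : ℝ) ≤ ⌊i * c⌋₊ + r * ⌈3 * c + 1⌉₊ := by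
    have : (r : ℝ) * (3 * c + 1) ≤ r * ⌈3 * c + 1⌉₊ := by
      gcongr
      exact Nat.le_ceil _
    have ht : 0 ≤ t := le_trans (by positivity) swaps_le
    nlinarith [Nat.floor_le ht, Nat.lt_floor_add_one (i * c)]
  exact ⟨⌊t⌋₊ - ⌊i * c⌋₊, Nat.sub_le_iff_le_add'.2 (by exact_mod_cast floor_le),
    (Nat.add_sub_cancel' floor_mono).symm⟩

end Reachable

section FewWords

variable [Fintype V] [DecidableRel T.Adj] [Fintype L]

section Append

variable {E : Type*} {i m : ℕ} (u : Fin i → E) (w : Fin m → E) (g : ℕ → E)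

theorem extend_append_castAdd (j : Fin i) :
    Function.extend Fin.val (Fin.append u w) g j = u j := by
  simpa using Fin.val_injective.extend_apply (Fin.append u w) g (Fin.castAdd m j)

theorem extend_append_natAdd (j : Fin m) :
    Function.extend Fin.val (Fin.append u w) g (i + j) = w j := by
  simpa using Fin.val_injective.extend_apply (Fin.append u w) g (Fin.natAdd i j)

end Append

variable {d i r p : ℕ} {c t : ℝ}

open scoped Classical in
theorem distAt_lt_subset_biUnion (hT : T.IsTree) (hc : 0 < c)
    (A : ProbeMoveAlgorithm T L S) (s : S) (M₀ : L ≃ V) (H₀ : L → V)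
    (hi : ⌊t / c⌋₊ = i + 2 * r) (hp : ⌊t⌋₊ = ⌊i * c⌋₊ + p)
    (u : Fin i → T.edgeSet) (g : ℕ → T.edgeSet) (a : ℝ) :
    let ξ₀ := Function.extend Fin.val u g
    ({w | distAt hT c A s M₀ H₀ (Function.extend Fin.val (Fin.append u w) g) t < a} :
        Finset (Fin (2 * r) → T.edgeSet)) ⊆
      (reachableStates A s (run hT c A s M₀ H₀ ξ₀ ⌊i * c⌋₊) p).biUnion fun y =>
        ({π | labelingDist T ((trueLabeling M₀ ξ₀ i).trans π) y.2 < a} :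
          Finset (Equiv.Perm V)).biUnion fun π =>
            {w | trueLabeling (.refl V) (Function.extend Fin.val w g) (2 * r) = π} := by
  intro ξ₀ w hw
  obtain ⟨y, hy, hdist⟩ := exists_mem_reachableStates_distAt_eq hT hc A s M₀ H₀ hi hp
    (ξ := Function.extend Fin.val (Fin.append u w) g) (ξ₀ := Function.extend Fin.val u g)
    fun j hj => by
      lift j to Fin i using hj
      rw [extend_append_castAdd, Fin.val_injective.extend_apply]
  have window : trueLabeling (.refl V)
      (fun j => Function.extend Fin.val (Fin.append u w) g (i + j)) (2 * r) =
      trueLabeling (.refl V) (Function.extend Fin.val w g) (2 * r) :=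
    dependsOn_trueLabeling _ _ fun j hj => by
      lift j to Fin (2 * r) using hj
      rw [extend_append_natAdd, Fin.val_injective.extend_apply]
  rw [window] at hdist
  refine mem_biUnion.2 ⟨y, hy, mem_biUnion.2 ⟨_, mem_filter.2 ⟨mem_univ _, ?_⟩,
    mem_filter.2 ⟨mem_univ _, rfl⟩⟩⟩
  exact hdist ▸ (mem_filter.1 hw).2

open scoped Classical in
theorem card_distAt_lt_mul_pow_le (hT : T.IsTree) (hc : 0 < c) (hd : ∀ v, T.degree v ≤ d)
    (A : ProbeMoveAlgorithm T L S) (s : S) (M₀ : L ≃ V) (H₀ : L → V)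
    (hi : ⌊t / c⌋₊ = i + 2 * r) (hp : ⌊t⌋₊ = ⌊i * c⌋₊ + p)
    (u : Fin i → T.edgeSet) (g : ℕ → T.edgeSet) (a : ℝ) {lam : ℝ} (hlam : 0 ≤ lam)
    (hdlam : d * Real.exp (-lam) ≤ 1 / 2) :
    (#{w : Fin (2 * r) → T.edgeSet |
        distAt hT c A s M₀ H₀ (Function.extend Fin.val (Fin.append u w) g) t < a} : ℝ) *
        Fintype.card T.edgeSet ^ r ≤
      (d + 1) ^ p * (Real.exp (lam * a + 2 * (d * Real.exp (-lam)) * Fintype.card L) *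
        (2 * ((2 * Fintype.card T.edgeSet) ^ (2 * r) * (4 * (d + 1) * r) ^ r))) := by
  set N := Fintype.card T.edgeSet
  set M₁ := trueLabeling M₀ (Function.extend Fin.val u g) i
  set states := reachableStates A s (run hT c A s M₀ H₀ (Function.extend Fin.val u g) ⌊i * c⌋₊) p
  set fibreBound : ℝ := 2 * ((2 * N) ^ (2 * r) * (4 * (d + 1) * r) ^ r)
  let fibre (π : Equiv.Perm V) : Finset (Fin (2 * r) → T.edgeSet) :=
    {w | trueLabeling (.refl V) (Function.extend Fin.val w g) (2 * r) = π}
  let near (y : List (Probe L V) × (L → V)) : Finset (Equiv.Perm V) :=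
    {π | labelingDist T (M₁.trans π) y.2 < a}
  have card_fibre (π : Equiv.Perm V) : (#(fibre π) : ℝ) * N ^ r ≤ fibreBound := by
    simp only [fibreBound]
    exact_mod_cast card_trueLabeling_eq_mul_pow_le hd g π r
  calc _ ≤ (∑ y ∈ states, ∑ π ∈ near y, (#(fibre π) : ℝ)) * N ^ r := by
        gcongr
        exact_mod_cast (card_le_card (distAt_lt_subset_biUnion hT hc A s M₀ H₀ hi hp u g a)).trans
          (card_biUnion_le.trans (sum_le_sum fun y _ => card_biUnion_le))
    _ = ∑ y ∈ states, ∑ π ∈ near y, #(fibre π) * (N : ℝ) ^ r := by simp only [sum_mul]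
    _ ≤ ∑ y ∈ states, #(near y) * fibreBound := sum_le_sum fun y _ =>
        (sum_le_card_nsmul _ _ _ fun π _ => card_fibre π).trans_eq (nsmul_eq_mul _ _)
    _ ≤ ∑ _y ∈ states, Real.exp (lam * a + 2 * (d * Real.exp (-lam)) * Fintype.card L) *
          fibreBound := by
        gcongr
        exact card_labelingDist_trans_lt_le hT.connected hd M₁ _ a hlam hdlam
    _ ≤ _ := by
        rw [sum_const, nsmul_eq_mul]
        gcongr
        exact_mod_cast card_reachableStates_le hd A s _ p

end FewWords

end Runs

section Probability

variable {Ω : Type*} [MeasurableSpace Ω] {P : Measure Ω}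

theorem sum_measureReal_le_of_card_le {ι : Type*} [Fintype ι] [IsProbabilityMeasure P]
    {C : ι → Set Ω} (hC : ∀ i, MeasurableSet (C i)) {ρ : ℝ}
    [∀ ω, DecidablePred fun i => ω ∈ C i] (hρ : ∀ ω, (#{i | ω ∈ C i} : ℝ) ≤ ρ) :
    ∑ i, P.real (C i) ≤ ρ := by
  have integrable_indicator (i : ι) : Integrable ((C i).indicator (1 : Ω → ℝ)) P :=
    (integrable_const (1 : ℝ)).indicator (hC i)
  calc ∑ i, P.real (C i) = ∑ i, ∫ ω, (C i).indicator (1 : Ω → ℝ) ω ∂P := by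
        simp only [integral_indicator_one (hC _)]
    _ = ∫ ω, ∑ i, (C i).indicator (1 : Ω → ℝ) ω ∂P :=
        (integral_finsetSum _ fun i _ => integrable_indicator i).symm
    _ ≤ ∫ _, ρ ∂P := by
        refine integral_mono (integrable_finsetSum _ fun i _ => integrable_indicator i)
          (integrable_const ρ) fun ω => le_of_eq_of_le ?_ (hρ ω)
        simp [Set.indicator_apply]
    _ = ρ := by simp

open scoped Classical in
theorem measureReal_mem_le_mul_of_indepFun {α ι : Type*} [MeasurableSpace α] [MeasurableSpace ι]
    [MeasurableSingletonClass ι] [Fintype ι] [IsProbabilityMeasure P] {X : Ω → α} {Y : Ω → ι}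
    (hX : Measurable X) (hXY : IndepFun X Y P) {q ρ : ℝ} (hq : 0 ≤ q)
    (hY : ∀ y, P.real {ω | Y ω = y} ≤ q) {B : ι → Set α} (hB : ∀ y, MeasurableSet (B y))
    (hρ : ∀ x, (#{y | x ∈ B y} : ℝ) ≤ ρ) : P.real {ω | X ω ∈ B (Y ω)} ≤ ρ * q := by
  have event_subset : {ω | X ω ∈ B (Y ω)} ⊆ ⋃ y, X ⁻¹' B y ∩ Y ⁻¹' {y} :=
    fun ω hω => Set.mem_iUnion.2 ⟨Y ω, hω, rfl⟩
  calc P.real {ω | X ω ∈ B (Y ω)} ≤ ∑ y, P.real (X ⁻¹' B y ∩ Y ⁻¹' {y}) :=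
        (measureReal_mono event_subset).trans (measureReal_iUnion_fintype_le _)
    _ = ∑ y, P.real (X ⁻¹' B y) * P.real {ω | Y ω = y} := by
        refine sum_congr rfl fun y _ => ?_
        simp only [measureReal_def, ← ENNReal.toReal_mul]
        exact congrArg _ (hXY.measure_inter_preimage_eq_mul _ _ (hB y) (measurableSet_singleton y))
    _ ≤ ∑ y, P.real (X ⁻¹' B y) * q := by gcongr; exact hY _
    _ ≤ ρ * q := by
        rw [← sum_mul]
        gcongr
        exact sum_measureReal_le_of_card_le (fun y => hX (hB y)) fun ω => hρ (X ω)

variable {V S : Type*} {T : SimpleGraph V} [MeasurableSpace S] {ξ : ℕ → Ω → T.edgeSet} {R : Ω → S}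

instance : DiscreteMeasurableSpace T.edgeSet :=
  ⟨fun _ => trivial⟩

theorem IsUniformEvolver.measureReal_prefix_eq (hξ : IsUniformEvolver P T ξ) {J : ℕ}
    (w : Fin J → T.edgeSet) :
    P.real {ω | (fun j : Fin J => ξ j ω) = w} = (1 / (Nat.card T.edgeSet : ℝ)) ^ J := by
  have eq_iInter : {ω | (fun j : Fin J => ξ j ω) = w} = ⋂ j ∈ univ, ξ (j : Fin J) ⁻¹' {w j} := by
    ext ω
    simp [funext_iff]
  rw [eq_iInter, measureReal_def, (hξ.indep.precomp Fin.val_injective).measure_inter_preimage_eq_mul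
    univ fun _ _ => measurableSet_singleton _, ENNReal.toReal_prod]
  exact (prod_congr rfl fun (j : Fin J) _ => hξ.uniform j (w j)).trans (by simp)

open scoped Classical in
theorem IsUniformEvolver.measureReal_mem_le_of_card_le [Fintype T.edgeSet] [IsProbabilityMeasure P]
    (hξ : IsUniformEvolver P T ξ) (hR : Measurable R) (hind : IndepFun R (fun ω j => ξ j ω) P)
    {i m : ℕ} {B : (ℕ → T.edgeSet) → Set S} (hB : ∀ g, MeasurableSet (B g))
    (hBdep : DependsOn B (Set.Iio (i + m))) {ρ : ℝ}
    (hρ : ∀ s u g, (#{w : Fin m → T.edgeSet |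
      s ∈ B (Function.extend Fin.val (Fin.append (u : Fin i → T.edgeSet) w) g)} : ℝ) ≤ ρ) :
    P.real {ω | R ω ∈ B fun j => ξ j ω} ≤ ρ / (Fintype.card T.edgeSet : ℝ) ^ m := by
  obtain ⟨ω₀⟩ := P.nonempty_of_neZero
  set g : ℕ → T.edgeSet := fun j => ξ j ω₀
  set N := Fintype.card T.edgeSet
  have N_pos : 0 < N := Fintype.card_pos_iff.2 ⟨g 0⟩
  have B_prefix (ω : Ω) : B (fun j => ξ j ω) =
      B (Function.extend Fin.val (fun j : Fin (i + m) => ξ j ω) g) :=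
    hBdep fun j hj => by
      lift j to Fin (i + m) using hj
      exact (Fin.val_injective.extend_apply (fun j : Fin (i + m) => ξ j ω) g j).symm
  have card_bad_le (s : S) :
      (#{v : Fin (i + m) → T.edgeSet | s ∈ B (Function.extend Fin.val v g)} : ℝ) ≤ N ^ i * ρ := by
    calc _ = ∑ u : Fin i → T.edgeSet, (#{w : Fin m → T.edgeSet |
            s ∈ B (Function.extend Fin.val (Fin.append u w) g)} : ℝ) := by
          simp only [card_filter, ← (Fin.appendEquiv i m).sum_comp, Fintype.sum_prod_type]
          push_cast
          rfl
      _ ≤ ∑ _u : Fin i → T.edgeSet, ρ := sum_le_sum fun u _ => hρ s u g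
      _ = N ^ i * ρ := by simp [N]
  have hprefix : IndepFun R (fun ω (j : Fin (i + m)) => ξ j ω) P :=
    hind.comp measurable_id
      (measurable_pi_lambda (fun (f : ℕ → T.edgeSet) (j : Fin (i + m)) => f j) fun j =>
        measurable_pi_apply _)
  simp only [B_prefix]
  refine (measureReal_mem_le_mul_of_indepFun hR hprefix (by positivity)
    (fun w => (hξ.measureReal_prefix_eq w).le) (fun w => hB _) card_bad_le).trans_eq ?_
  rw [Nat.card_eq_fintype_card]
  change N ^ i * ρ * (1 / N) ^ (i + m) = ρ / N ^ m
  simp only [one_div_pow, pow_add]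
  field_simp

end Probability

section Constants

theorem two_mul_pow_mul_div_le {b x y z δ : ℝ} (hb : 0 ≤ b) (hx : 0 < x) (hδ : 0 ≤ δ)
    (hy : y ≤ δ * x) (hz : x / 2 ≤ z) (m : ℕ) :
    2 * (b ^ m * (16 * b * y / z)) ≤ 64 * b ^ (m + 1) * δ := by
  calc 2 * (b ^ m * (16 * b * y / z)) ≤ 2 * (b ^ m * (16 * b * (δ * x) / (x / 2))) := by gcongr
    _ = 64 * b ^ (m + 1) * δ := by
      field_simp
      ring

variable {Ω V L S : Type*} [MeasurableSpace Ω] {P : Measure Ω} [IsProbabilityMeasure P]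
  [Fintype V] [DecidableEq V] [Fintype L] [DecidableEq L] {T : SimpleGraph V} [DecidableRel T.Adj]
  [MeasurableSpace S] {ξ : ℕ → Ω → T.edgeSet} {R : Ω → S} {d r : ℕ} {c t lam : ℝ}

theorem IsUniformEvolver.measureReal_distAt_lt_le (hξ : IsUniformEvolver P T ξ)
    (hR : Measurable R) (hind : IndepFun R (fun ω j => ξ j ω) P) (hT : T.IsTree) (hc : 0 < c)
    (hd : ∀ v, T.degree v ≤ d) (A : ProbeMoveAlgorithm T L S) (M₀ : L ≃ V) (H₀ : L → V)
    (hr : 1 ≤ r) (ht : 2 * r * c ≤ t) (a : ℝ) (hlam : 0 ≤ lam)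
    (hdlam : d * Real.exp (-lam) ≤ 1 / 2) :
    P.real {ω | distAt hT c A (R ω) M₀ H₀ (fun j => ξ j ω) t < a} ≤
      2 * ((d + 1) ^ ⌈3 * c + 1⌉₊ * (16 * (d + 1) * r / Fintype.card T.edgeSet)) ^ r *
        Real.exp (lam * a + 2 * (d * Real.exp (-lam)) * Fintype.card L) := by
  set N := Fintype.card T.edgeSet
  set C := ⌈3 * c + 1⌉₊
  set η := Real.exp (lam * a + 2 * (d * Real.exp (-lam)) * Fintype.card L)
  have N_pos : (0 : ℝ) < N := by
    obtain ⟨ω⟩ := P.nonempty_of_neZero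
    exact_mod_cast Fintype.card_pos_iff.2 ⟨ξ 0 ω⟩
  obtain ⟨i, hi⟩ := Nat.exists_eq_add_of_le' (Nat.le_floor (by
    rw [le_div_iff₀ hc]
    exact_mod_cast ht) : 2 * r ≤ ⌊t / c⌋₊)
  obtain ⟨p, p_le, hp⟩ := exists_le_floor_eq_floor_mul_add hc hr hi
  have depends : DependsOn (fun g => {s | (distAt hT c A s M₀ H₀ g t : ℝ) < a})
      (Set.Iio (i + 2 * r)) := fun g g' h => by
    ext s
    simp only [Set.mem_ofPred_eq,
      dependsOn_distAt hT hc A s M₀ H₀ (le_trans (by positivity) ht) (hi ▸ h)]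
  refine (hξ.measureReal_mem_le_of_card_le hR hind
    (fun g => measurableSet_distAt_lt hT c A M₀ H₀ g t a) depends
    (ρ := (d + 1) ^ (r * C) * (η * (2 * ((2 * N) ^ (2 * r) * (4 * (d + 1) * r) ^ r))) / N ^ r)
    fun s u g => ?_).trans_eq ?_
  · rw [le_div_iff₀ (by positivity)]
    refine (card_distAt_lt_mul_pow_le hT hc hd A s M₀ H₀ hi hp u g a hlam hdlam).trans ?_
    gcongr
    exact le_add_of_nonneg_left d.cast_nonneg
  · change _ / (N : ℝ) ^ (2 * r) = _
    rw [show (16 : ℝ) = 2 ^ 2 * 4 by norm_num, mul_comm r C]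
    simp only [mul_pow, div_pow, pow_mul]
    field_simp

theorem IsUniformEvolver.measureReal_distAt_lt_le_exp (hξ : IsUniformEvolver P T ξ)
    (hR : Measurable R) (hind : IndepFun R (fun ω j => ξ j ω) P) (hT : T.IsTree) (hc : 0 < c)
    (hd : ∀ v, T.degree v ≤ d) (A : ProbeMoveAlgorithm T L S) (M₀ : L ≃ V) (H₀ : L → V)
    {δ a : ℝ} (hδ : 64 * (d + 1) ^ (⌈3 * c + 1⌉₊ + 1) * δ ≤ Real.exp (-3))
    (hV : 2 ≤ δ * Fintype.card V) (ht : 2 * (δ * Fintype.card V) * c ≤ t) (hlam : 0 ≤ lam)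
    (hdlam : d * Real.exp (-lam) ≤ δ / 8) (ha : lam * a ≤ δ * Fintype.card V / 4) :
    P.real {ω | distAt hT c A (R ω) M₀ H₀ (fun j => ξ j ω) t < a} ≤
      Real.exp (-(δ * Fintype.card V)) := by
  set C := ⌈3 * c + 1⌉₊
  set n := Fintype.card V
  set r := ⌊δ * n⌋₊
  have δ_pos : 0 < δ := pos_of_mul_pos_left (zero_lt_two.trans_le hV) n.cast_nonneg
  have δ_le_one : δ ≤ 1 := by
    have one_le : (1 : ℝ) ≤ (d + 1) ^ (C + 1) := one_le_pow₀ (by simp)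
    have : Real.exp (-3) ≤ 1 := Real.exp_le_one_iff.2 (by norm_num)
    nlinarith
  have r_le : r ≤ δ * n := Nat.floor_le (by linarith)
  have lt_r_add_one : δ * n < r + 1 := Nat.lt_floor_add_one _
  have one_le_r : 1 ≤ r := Nat.le_floor (by push_cast; linarith)
  have half_le_card_edgeSet : (n : ℝ) / 2 ≤ Fintype.card T.edgeSet := by
    have card_edgeSet : (Fintype.card T.edgeSet : ℝ) + 1 = n := by
      exact_mod_cast SimpleGraph.edgeFinset_card (G := T) ▸ hT.card_edgeFinset
    nlinarith
  have base_le : 2 * ((d + 1 : ℝ) ^ C * (16 * (d + 1) * r / Fintype.card T.edgeSet)) ≤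
      Real.exp (-3) :=
    (two_mul_pow_mul_div_le (by positivity) (by nlinarith) δ_pos.le
      r_le half_le_card_edgeSet C).trans hδ
  calc _ ≤ 2 * ((d + 1) ^ C * (16 * (d + 1) * r / Fintype.card T.edgeSet)) ^ r *
        Real.exp (lam * a + 2 * (d * Real.exp (-lam)) * Fintype.card L) :=
        hξ.measureReal_distAt_lt_le hR hind hT hc hd A M₀ H₀ one_le_r
          (ht.trans' (by gcongr)) a hlam (by linarith)
    _ ≤ Real.exp (-3) ^ r * Real.exp (δ * n / 4 + 2 * (δ / 8) * n) := by
        rw [Fintype.card_congr M₀]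
        gcongr
        refine le_trans ?_ (pow_le_pow_left₀ (by positivity) base_le r)
        rw [mul_pow 2]
        gcongr
        exact le_self_pow₀ one_le_two (by omega)
    _ ≤ Real.exp (-(δ * n)) := by
        rw [← Real.exp_nat_mul, ← Real.exp_add]
        exact Real.exp_le_exp.2 (by linarith)

end Constants

end EvolvingTree

theorem mainTheorem1_general (k : ℕ) (c : ℝ) (hc : 0 < c) :
    ∃ α β K : ℝ, 0 < α ∧ 0 < β ∧ 0 < K ∧ ∃ N : ℕ, ∀ n : ℕ, N ≤ n →
      ∀ (V L : Type*) [Fintype V] [DecidableEq V] [Fintype L] [DecidableEq L]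
        (T : SimpleGraph V) [DecidableRel T.Adj] (hT : T.IsTree),
        Fintype.card V = n → (∀ v, T.degree v ≤ k) →
      ∀ (S Ω : Type*) [MeasurableSpace S] [MeasurableSpace Ω]
        (A : ProbeMoveAlgorithm T L S) (M₀ : L ≃ V) (H₀ : L → V)
        (P : Measure Ω) [IsProbabilityMeasure P] (ξ : ℕ → Ω → T.edgeSet) (R : Ω → S),
        IsUniformEvolver P T ξ → Measurable R → IndepFun R (fun ω j => ξ j ω) P →
      ∀ t : ℝ, K * n ≤ t →
        1 - Real.exp (-β * n) ≤
          P.real {ω | α * n ≤ (distAt hT c A (R ω) M₀ H₀ (fun j => ξ j ω) t : ℝ)} := by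
  obtain ⟨δ, δ_pos, hδ⟩ : ∃ δ > 0, 64 * (k + 1 : ℝ) ^ (⌈3 * c + 1⌉₊ + 1) * δ = Real.exp (-3) :=
    ⟨Real.exp (-3) / (64 * (k + 1) ^ (⌈3 * c + 1⌉₊ + 1)), by positivity, by field_simp⟩
  obtain ⟨lam, lam_pos, hlam⟩ : ∃ lam > 0, k * Real.exp (-lam) ≤ δ / 8 := by
    have tendsto_zero : Filter.Tendsto (fun x => k * Real.exp (-x)) Filter.atTop (nhds 0) := by
      simpa using Real.tendsto_exp_neg_atTop_nhds_zero.const_mul (k : ℝ)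
    exact ((Filter.eventually_gt_atTop 0).and
      (tendsto_zero.eventually_le_const (by positivity))).exists
  refine ⟨δ / (4 * lam), δ, 2 * δ * c, by positivity, δ_pos, by positivity, ⌈2 / δ⌉₊, ?_⟩
  rintro n hn V L _ _ _ _ T _ hT rfl hk S Ω _ _ A M₀ H₀ P _ ξ R hξ hR hind t ht
  have two_le : 2 ≤ δ * Fintype.card V := (div_le_iff₀' δ_pos).1 (Nat.ceil_le.1 hn)
  have failure_le := hξ.measureReal_distAt_lt_le_exp hR hind hT hc hk A M₀ H₀ hδ.le two_le
    (ht.trans_eq' (by ring)) lam_pos.le hlam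
    (a := δ / (4 * lam) * Fintype.card V) (le_of_eq (by field_simp))
  rw [neg_mul, sub_le_comm]
  refine le_trans ?_ failure_le
  rw [← probReal_univ (μ := P), sub_le_iff_le_add]
  exact (measureReal_mono fun ω _ => lt_or_ge (α := ℝ) _ _).trans (measureReal_union_le _ _)

theorem mainTheorem1 (k : ℕ) (c : ℝ) (hc : 1 ≤ c) :
    ∃ α β K : ℝ, 0 < α ∧ 0 < β ∧ 0 < K ∧ ∃ N : ℕ, ∀ n : ℕ, N ≤ n →
      ∀ (V L : Type*) [Fintype V] [DecidableEq V] [Fintype L] [DecidableEq L]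
        (T : SimpleGraph V) [DecidableRel T.Adj] (hT : T.IsTree),
        Fintype.card V = n → (∀ v, T.degree v ≤ k) →
      ∀ (S Ω : Type*) [MeasurableSpace S] [MeasurableSpace Ω]
        (A : ProbeMoveAlgorithm T L S) (M₀ : L ≃ V) (H₀ : L → V)
        (P : Measure Ω) [IsProbabilityMeasure P] (ξ : ℕ → Ω → T.edgeSet) (R : Ω → S),
        IsUniformEvolver P T ξ → Measurable R → IndepFun R (fun ω j => ξ j ω) P →
      ∀ t : ℝ, K * n ≤ t →
        1 - Real.exp (-β * n) ≤
          P.real {ω | α * n ≤ (distAt hT c A (R ω) M₀ H₀ (fun j => ξ j ω) t : ℝ)} := by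
  exact mainTheorem1_general k c (zero_lt_one.trans_le hc)
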